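/- For $p\in\{1,2,3,\dots\}\cup\{\infty\}$ let $\Sigma_p$ be the inverse limit of unit circles $S^1\subset\mathbb C$, $\Sigma_p=\varprojlim\{S^1\leftarrow S^1\leftarrow S^1\leftarrow\cdots\}$, where for finite $p$ all bonding maps are $z\mapsto z^p$ (the $p$-adic solenoid), and for $p=\infty$ the successive bonding maps are $z\mapsto z^2$, $z\mapsto z^3$, $z\mapsto z^4,\dots$ (the adelic solenoid). Let $X$ be a metric space. A map $f:X\to\mathbb R$ is slowly oscillating if for every $r>0$ the diameter of $f(B(x,r))$ tends to $0$ as $x$ tends to infinity (i.e. as the distance from $x$ to a fixed base point tends to infinity). Let $C_h$ be the set of all bounded continuous slowly oscillating functions $f:X\to\mathbb R$. The Higson compactification $\bar X$ is the closure of the image of $X$ under the map $(f)_{f\in C_h}:X\to\prod_{f\in C_h}[\inf f,\sup f]$. A continuous map $f:Y\to Z$ is essential if every continuous map $g:Y\to Z$ homotopic to $f$ is surjective. **Corollary.** Let $p\in\{1,2,3,\dots\}\cup\{\infty\}$ and let $X$ be a non-compact, simply connected, proper geodesic metric space. Then there are an index set $\mathcal A$ and a topological embedding $F:\bar X\to\prod_{\alpha\in\mathcal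 A}\Sigma_p$ such that for every $\alpha\in\mathcal A$ the coordinate map $\bar X\to\Sigma_p$ of $F$ is essential. -/

import Mathlib

open Set Filter Topology

universe u

/-- A metric space is geodesic if any two points `x`, `y` are joined by an isometric embedding
of the interval `[0, d(x, y)]`. -/
def IsGeodesicSpace (X : Type*) [MetricSpace X] : Prop :=
  ∀ x y : X, ∃ ξ : Icc (0 : ℝ) (dist x y) → X, Isometry ξ ∧
    ξ ⟨0, left_mem_Icc.2 dist_nonneg⟩ = x ∧ ξ ⟨dist x y, right_mem_Icc.2 dist_nonneg⟩ = y

/-- A map `f` between metric spaces is slowly oscillating if for every `r > 0` the diameter of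
`f (B(x, r))` tends to `0` as `x` tends to infinity, that is, as the distance from `x` to a
(equivalently, any) base point tends to infinity. -/
def SlowlyOscillating {X Y : Type*} [MetricSpace X] [MetricSpace Y] (f : X → Y) : Prop :=
  ∀ r : ℝ, 0 < r →
    Tendsto (fun x : X => Metric.ediam (f '' Metric.ball x r)) (Bornology.cobounded X) (𝓝 0)

/-- The type of bounded continuous slowly oscillating real functions on `X`. -/
abbrev HigsonFunction (X : Type*) [MetricSpace X] : Type _ :=
  {f : BoundedContinuousFunction X ℝ // SlowlyOscillating (f : X → ℝ)}

/-- The interval `[inf f, sup f]`. -/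
abbrev HigsonFunction.interval {X : Type*} [MetricSpace X] (f : HigsonFunction X) : Set ℝ :=
  Icc (⨅ x : X, f.1 x) (⨆ x : X, f.1 x)

/-- The map `X → ∏ [inf f, sup f]`, the product over all bounded continuous slowly oscillating
functions `f : X → ℝ`, whose coordinates are these functions. -/
def higsonMap (X : Type*) [MetricSpace X] (x : X) : (f : HigsonFunction X) → f.interval :=
  fun f => ⟨f.1 x, ciInf_le f.1.isBounded_range.bddBelow x,
    le_ciSup f.1.isBounded_range.bddAbove x⟩

/-- The Higson compactification of `X`: the closure of the image of `X` in `∏ [inf f, sup f]`. -/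
abbrev HigsonCompactification (X : Type*) [MetricSpace X] : Type _ :=
  closure (range (higsonMap X))

/-- The degrees of the bonding maps of the solenoid: constantly `p` for finite `p`, and
`2, 3, 4, …` for `p = ∞`. -/
def solenoidDegree (p : ℕ∞) (k : ℕ) : ℕ :=
  if p = ⊤ then k + 2 else p.toNat

/-- The solenoid `Σ_p`: the inverse limit of unit circles under the bonding maps `z ↦ z ^ p`
(`p`-adic solenoid) and, for `p = ∞`, under the bonding maps `z ↦ z ^ 2, z ^ 3, z ^ 4, …`
(adelic solenoid), as a subspace of the product of the circles. -/
abbrev Solenoid (p : ℕ∞) : Type :=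
  {z : ℕ → Circle // ∀ k : ℕ, z (k + 1) ^ solenoidDegree p k = z k}

/-- A map is essential if every map homotopic to it is surjective. -/
def IsEssentialMap {Y Z : Type*} [TopologicalSpace Y] [TopologicalSpace Z] (f : C(Y, Z)) : Prop :=
  ∀ g : C(Y, Z), f.Homotopic g → Function.Surjective g

/-- An embedding into a product is essential if its composition with the projection onto each
factor is essential. -/
def IsEssentialEmbedding {Y ι : Type*} {Z : ι → Type*} [TopologicalSpace Y]
    [∀ i, TopologicalSpace (Z i)] (F : C(Y, (i : ι) → Z i)) : Prop :=
  IsEmbedding F ∧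
    ∀ i : ι, IsEssentialMap ((ContinuousMap.eval i).comp F)

/-! The factors are indexed by the Higson functions `f`. With `ℓ = log (1 + dist x x₀)`, the
function `h = ℓ + f` is slowly oscillating but unbounded. Winding the line around the solenoid by `t
↦ (exp (i t / N_n))_n`, where `N_n` is `solenoidIndex p n`, makes it Lipschitz in each coordinate,
so `h` yields a map that extends to the compactification (`exists_extension_solenoid`). A homotopy
changes the angle in each coordinate only by a bounded function, which cannot cancel the
unboundedness of `ℓ`; hence essentiality (`isEssentialMap_of_extends`). Dividing the map for `c • f`
by the map for `0` leaves `exp (i c f)` in coordinate `0`. Letting `c` vary recovers `f`, so the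
maps jointly separate points, and compactness gives an embedding. -/

theorem SlowlyOscillating.comp_lipschitzWith {X Y Z : Type*} [MetricSpace X] [MetricSpace Y]
    [MetricSpace Z] {K : NNReal} {φ : Y → Z} {f : X → Y} (hf : SlowlyOscillating f)
    (hφ : LipschitzWith K φ) : SlowlyOscillating (φ ∘ f) := by
  intro r hr
  have h : Tendsto (fun x : X => (K : ENNReal) * Metric.ediam (f '' Metric.ball x r))
      (Bornology.cobounded X) (𝓝 0) := by
    simpa using ENNReal.Tendsto.const_mul (hf r hr) (Or.inr ENNReal.coe_ne_top)
  refine tendsto_of_tendsto_of_tendsto_of_le_of_le tendsto_const_nhds h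
    (fun _ => zero_le) fun x => ?_
  rw [image_comp]
  exact hφ.ediam_image_le _

theorem SlowlyOscillating.add {X Y : Type*} [MetricSpace X] [NormedAddCommGroup Y] {f g : X → Y}
    (hf : SlowlyOscillating f) (hg : SlowlyOscillating g) :
    SlowlyOscillating (fun x => f x + g x) := by
  intro r hr
  have h := (hf r hr).add (hg r hr)
  rw [add_zero] at h
  refine tendsto_of_tendsto_of_tendsto_of_le_of_le tendsto_const_nhds h
    (fun _ => zero_le) fun x => ?_
  rw [Metric.ediam_image_le_iff]
  intro y hy z hz
  exact (edist_add_add_le _ _ _ _).trans (add_le_add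
    (Metric.edist_le_ediam_of_mem (mem_image_of_mem f hy) (mem_image_of_mem f hz))
    (Metric.edist_le_ediam_of_mem (mem_image_of_mem g hy) (mem_image_of_mem g hz)))

theorem lipschitzWith_const_mul (c : ℝ) : LipschitzWith ‖c‖₊ (fun t : ℝ => c * t) := by
  refine LipschitzWith.of_dist_le_mul fun s t => ?_
  rw [Real.dist_eq, Real.dist_eq, ← mul_sub, abs_mul]
  rfl

theorem lipschitzWith_circle_exp : LipschitzWith 1 (fun t : ℝ => Circle.exp t) := by
  refine LipschitzWith.of_dist_le_mul fun s t => ?_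
  have h : (Circle.exp s : ℂ) - Circle.exp t
      = Circle.exp t * (Complex.exp (Complex.I * (s - t : ℝ)) - 1) := by
    simp only [Circle.coe_exp, mul_sub, mul_one, ← Complex.exp_add]
    congr 2
    push_cast
    ring
  change dist (Circle.exp s : ℂ) (Circle.exp t) ≤ _
  rw [dist_eq_norm]
  rw [h, norm_mul, Circle.norm_coe]
  simpa [Real.dist_eq] using Real.norm_exp_I_mul_ofReal_sub_one_le (x := s - t)

theorem abs_log_sub_log_le {m a b : ℝ} (hm : 0 < m) (ha : m ≤ a) (hb : m ≤ b) :
    |Real.log a - Real.log b| ≤ |a - b| / m := by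
  have key : ∀ {a b : ℝ}, m ≤ a → m ≤ b → Real.log a - Real.log b ≤ |a - b| / m := by
    intro a b ha hb
    have hb0 := hm.trans_le hb
    have ha0 := hm.trans_le ha
    rw [← Real.log_div ha0.ne' hb0.ne']
    calc Real.log (a / b) ≤ a / b - 1 := Real.log_le_sub_one_of_pos (div_pos ha0 hb0)
      _ = (a - b) / b := by field_simp
      _ ≤ |a - b| / b := by gcongr; exact le_abs_self _
      _ ≤ |a - b| / m := by gcongr
  refine abs_le.2 ⟨?_, key ha hb⟩
  have := key hb ha
  rw [abs_sub_comm] at this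
  linarith

/-- The slope of the logarithm decays: far out, the oscillation on the `r`-ball is at most `2r / (1
+ dist x x₀ - r)`. -/
theorem slowlyOscillating_log_dist {X : Type*} [MetricSpace X] (x₀ : X) :
    SlowlyOscillating (fun x => Real.log (1 + dist x x₀)) := by
  intro r hr
  have hlim : Tendsto (fun x : X => ENNReal.ofReal (2 * r / (1 + dist x x₀ - r)))
      (Bornology.cobounded X) (𝓝 0) := by
    rw [← ENNReal.ofReal_zero]
    refine (ENNReal.continuous_ofReal.tendsto 0).comp (Tendsto.const_div_atTop ?_ _)
    have h := tendsto_atTop_add_const_right _ (1 - r) (Metric.tendsto_dist_right_cobounded_atTop x₀)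
    refine h.congr fun x => by ring
  refine tendsto_of_tendsto_of_tendsto_of_le_of_le' tendsto_const_nhds hlim
    (Eventually.of_forall fun _ => zero_le) ?_
  filter_upwards [(Metric.tendsto_dist_right_cobounded_atTop x₀).eventually_ge_atTop r] with x hx
  rw [Metric.ediam_image_le_iff]
  have far : ∀ y ∈ Metric.ball x r, 1 + dist x x₀ - r ≤ 1 + dist y x₀ := by
    intro y hy
    have := dist_triangle x y x₀
    rw [Metric.mem_ball'] at hy
    linarith
  intro y hy z hz
  have hm : 0 < 1 + dist x x₀ - r := by linarith
  rw [edist_dist, Real.dist_eq]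
  refine ENNReal.ofReal_le_ofReal ((abs_log_sub_log_le hm (far y hy) (far z hz)).trans ?_)
  gcongr
  have h1 : |1 + dist y x₀ - (1 + dist z x₀)| ≤ dist y z := by
    rw [add_sub_add_left_eq_sub]
    exact abs_dist_sub_le y z x₀
  have h2 := dist_triangle_right y z x
  rw [Metric.mem_ball] at hy hz
  linarith

/-! ### Extending maps to the Higson compactification -/

instance (X : Type*) [MetricSpace X] : CompactSpace (HigsonCompactification X) :=
  isCompact_iff_compactSpace.1 isClosed_closure.isCompact

/-- The canonical map of `X` into its Higson compactification. -/
def toHigson {X : Type*} [MetricSpace X] (x : X) : HigsonCompactification X :=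
  ⟨higsonMap X x, subset_closure (mem_range_self x)⟩

/-- The continuous extension of a Higson function to the Higson compactification. -/
def HigsonFunction.extend {X : Type*} [MetricSpace X] (f : HigsonFunction X) :
    C(HigsonCompactification X, ℝ) :=
  ⟨fun z => (z.1 f : ℝ),
    continuous_subtype_val.comp ((continuous_apply f).comp continuous_subtype_val)⟩

theorem HigsonFunction.extend_toHigson {X : Type*} [MetricSpace X] (f : HigsonFunction X) (x : X) :
    f.extend (toHigson x) = f.1 x := rfl

theorem denseRange_toHigson {X : Type*} [MetricSpace X] :
    DenseRange (toHigson : X → HigsonCompactification X) := by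
  rw [DenseRange, Subtype.dense_iff]
  intro z hz
  rwa [← range_comp]

theorem HigsonCompactification.ext_of_extend {X : Type*} [MetricSpace X]
    {z w : HigsonCompactification X} (h : ∀ f : HigsonFunction X, f.extend z = f.extend w) :
    z = w :=
  Subtype.ext (funext fun f => Subtype.ext (h f))

theorem continuous_toHigson {X : Type*} [MetricSpace X] :
    Continuous (toHigson : X → HigsonCompactification X) :=
  Continuous.subtype_mk
    (continuous_pi fun f : HigsonFunction X => f.1.continuous.subtype_mk _) _

theorem exists_extension_real {X : Type*} [MetricSpace X] (f : X → ℝ) (hf : Continuous f) (C : ℝ)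
    (hC : ∀ x, ‖f x‖ ≤ C) (hs : SlowlyOscillating f) :
    ∃ e : C(HigsonCompactification X, ℝ), ∀ x, e (toHigson x) = f x :=
  ⟨HigsonFunction.extend ⟨BoundedContinuousFunction.ofNormedAddCommGroup f hf C hC, hs⟩,
    fun _ => rfl⟩

theorem lipschitzWith_circle_re : LipschitzWith 1 (fun z : Circle => (z : ℂ).re) := by
  refine LipschitzWith.of_dist_le_mul fun z w => ?_
  change _ ≤ _ * dist (z : ℂ) w
  rw [Real.dist_eq, NNReal.coe_one, one_mul, dist_eq_norm, ← Complex.sub_re]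
  exact Complex.abs_re_le_norm _

theorem lipschitzWith_circle_im : LipschitzWith 1 (fun z : Circle => (z : ℂ).im) := by
  refine LipschitzWith.of_dist_le_mul fun z w => ?_
  change _ ≤ _ * dist (z : ℂ) w
  rw [Real.dist_eq, NNReal.coe_one, one_mul, dist_eq_norm, ← Complex.sub_im]
  exact Complex.abs_im_le_norm _

/-- Real and imaginary parts extend separately; the extension keeps norm `1` because `X` is dense.
-/
theorem exists_extension_circle {X : Type*} [MetricSpace X] (φ : X → Circle) (hφ : Continuous φ)
    (hs : SlowlyOscillating φ) :
    ∃ E : C(HigsonCompactification X, Circle), ∀ x, E (toHigson x) = φ x := by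
  obtain ⟨c, hc⟩ := exists_extension_real ((fun z : Circle => (z : ℂ).re) ∘ φ)
    (lipschitzWith_circle_re.continuous.comp hφ) 1
    (fun x => (Complex.abs_re_le_norm _).trans_eq (Circle.norm_coe _))
    (hs.comp_lipschitzWith lipschitzWith_circle_re)
  obtain ⟨s, hs⟩ := exists_extension_real ((fun z : Circle => (z : ℂ).im) ∘ φ)
    (lipschitzWith_circle_im.continuous.comp hφ) 1
    (fun x => (Complex.abs_im_le_norm _).trans_eq (Circle.norm_coe _))
    (hs.comp_lipschitzWith lipschitzWith_circle_im)
  let e : C(HigsonCompactification X, ℂ) :=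
    ⟨fun z => (c z : ℂ) + s z * Complex.I, by fun_prop⟩
  have hex (x : X) : e (toHigson x) = φ x := by
    change (c (toHigson x) : ℂ) + s (toHigson x) * Complex.I = φ x
    rw [hc, hs]
    exact Complex.re_add_im _
  have hmem (z : HigsonCompactification X) : e z ∈ Submonoid.unitSphere ℂ := by
    have hn : ‖e z‖ = 1 := by
      refine denseRange_toHigson.induction_on (p := fun z => ‖e z‖ = 1) z
        (isClosed_eq (by fun_prop) (by fun_prop)) fun x => ?_
      rw [hex, Circle.norm_coe]
    exact mem_sphere_zero_iff_norm.2 hn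
  exact ⟨⟨fun z => ⟨e z, hmem z⟩, e.continuous.subtype_mk hmem⟩, fun x => Subtype.ext (hex x)⟩

/-- The quotient `g / f` is homotopic to the constant `1`, so it lifts through the covering
`Circle.exp`. -/
theorem exists_lift_of_homotopic_circle {Y : Type*} [TopologicalSpace Y] {f g : C(Y, Circle)}
    (h : f.Homotopic g) : ∃ u : C(Y, ℝ), ∀ y, g y = f y * Circle.exp (u y) := by
  obtain ⟨H⟩ := h
  let D : C(unitInterval × Y, Circle) :=
    ⟨fun q => H q / f q.2, by fun_prop⟩
  have hD (y : Y) : D (0, y) = Circle.exp ((0 : C(Y, ℝ)) y) := by simp [D]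
  let L := Circle.isCoveringMap_exp.liftHomotopy D 0 hD
  refine ⟨⟨fun y => L (1, y), by fun_prop⟩, fun y => ?_⟩
  have h1 : Circle.exp (L (1, y)) = D (1, y) :=
    congrFun (Circle.isCoveringMap_exp.liftHomotopy_lifts D 0 hD) (1, y)
  simp [h1, D]

/-! ### Maps into the solenoid and essentiality -/

/-- The projection of the solenoid onto a coordinate circle. -/
def Solenoid.coord (p : ℕ∞) (n : ℕ) : C(Solenoid p, Circle) :=
  ⟨fun z => z.1 n, (continuous_apply n).comp continuous_subtype_val⟩

/-- The degree of the projection of the solenoid from its `n`-th to its zeroth coordinate. -/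
def solenoidIndex (p : ℕ∞) (n : ℕ) : ℕ := ∏ k ∈ Finset.range n, solenoidDegree p k

theorem solenoidDegree_pos {p : ℕ∞} (hp : p ≠ 0) (k : ℕ) : 0 < solenoidDegree p k := by
  unfold solenoidDegree
  split_ifs with h
  · omega
  · exact Nat.pos_of_ne_zero fun h0 => (ENat.toNat_eq_zero.1 h0).elim hp h

theorem solenoidIndex_pos {p : ℕ∞} (hp : p ≠ 0) (n : ℕ) : 0 < solenoidIndex p n :=
  Finset.prod_pos fun k _ => solenoidDegree_pos hp k

theorem circle_exp_div_solenoidIndex_pow {p : ℕ∞} (hp : p ≠ 0) (t : ℝ) (k : ℕ) :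
    Circle.exp (t / solenoidIndex p (k + 1)) ^ solenoidDegree p k
      = Circle.exp (t / solenoidIndex p k) := by
  rw [← Circle.exp_natCast_mul]
  congr 1
  have h1 : (solenoidIndex p k : ℝ) ≠ 0 := by exact_mod_cast (solenoidIndex_pos hp k).ne'
  have h2 : (solenoidDegree p k : ℝ) ≠ 0 := by exact_mod_cast (solenoidDegree_pos hp k).ne'
  rw [solenoidIndex, Finset.prod_range_succ, ← solenoidIndex]
  push_cast
  field_simp

theorem exists_extension_solenoid {X : Type*} [MetricSpace X] {p : ℕ∞} (hp : p ≠ 0) (h : X → ℝ)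
    (hc : Continuous h) (hs : SlowlyOscillating h) :
    ∃ E : C(HigsonCompactification X, Solenoid p),
      ∀ x n, (E (toHigson x)).1 n = Circle.exp (h x / solenoidIndex p n) := by
  have (n : ℕ) : ∃ E : C(HigsonCompactification X, Circle),
      ∀ x, E (toHigson x) = Circle.exp (h x / solenoidIndex p n) := by
    refine exists_extension_circle _ (by fun_prop) ?_
    simp_rw [div_eq_inv_mul]
    exact (hs.comp_lipschitzWith (lipschitzWith_const_mul _)).comp_lipschitzWith
      lipschitzWith_circle_exp
  choose E hE using this
  have hmem (z : HigsonCompactification X) (k : ℕ) :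
      E (k + 1) z ^ solenoidDegree p k = E k z := by
    refine denseRange_toHigson.induction_on
      (p := fun z => E (k + 1) z ^ solenoidDegree p k = E k z) z
      (isClosed_eq (by fun_prop) (by fun_prop)) fun x => ?_
    rw [hE, hE, circle_exp_div_solenoidIndex_pow hp]
  exact ⟨⟨fun z => ⟨fun n => E n z, hmem z⟩,
    (continuous_pi fun n => (E n).continuous).subtype_mk hmem⟩, fun x n => hE n x⟩

/-- Coordinate `n + 1` determines coordinate `n`, so the coordinate fibres over a point form a
decreasing sequence of nonempty compact sets. -/
theorem surjective_of_surjective_coordinates {Y : Type*} [TopologicalSpace Y] [CompactSpace Y]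
    {p : ℕ∞} (g : C(Y, Solenoid p))
    (hg : ∀ n, Function.Surjective fun y => (g y).1 n) : Function.Surjective g := by
  intro w
  have hclosed (n : ℕ) : IsClosed {y | (g y).1 n = w.1 n} :=
    isClosed_eq ((Solenoid.coord p n).comp g).continuous continuous_const
  obtain ⟨y, hy⟩ := IsCompact.nonempty_iInter_of_sequence_nonempty_isCompact_isClosed
    (fun n => {y | (g y).1 n = w.1 n})
    (fun n y (hy : (g y).1 (n + 1) = w.1 (n + 1)) => by
      change (g y).1 n = w.1 n
      rw [← (g y).2 n, ← w.2 n, hy])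
    (fun n => hg n (w.1 n)) (hclosed 0).isCompact hclosed
  exact ⟨y, Subtype.ext (funext fun n => mem_iInter.1 hy n)⟩

theorem surjective_circle_exp_of_not_bddAbove {X : Type*} [TopologicalSpace X]
    [PreconnectedSpace X] {h : X → ℝ} (hc : Continuous h) (hu : ¬ BddAbove (range h)) :
    Function.Surjective fun x => Circle.exp (h x) := by
  intro w
  obtain ⟨t, rfl⟩ := Circle.exp_surjective w
  obtain ⟨_, ⟨x₁, rfl⟩, -⟩ := not_bddAbove_iff.1 hu 0
  -- Enough full turns lift the angle `t` above the value `h x₁`; the intermediate value theorem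
  -- then applies.
  obtain ⟨n, hn⟩ := exists_nat_gt ((h x₁ - t) / (2 * Real.pi))
  rw [div_lt_iff₀ Real.two_pi_pos] at hn
  obtain ⟨_, ⟨x₂, rfl⟩, h₂⟩ := not_bddAbove_iff.1 hu (t + n * (2 * Real.pi))
  obtain ⟨x, hx⟩ := mem_range_of_exists_le_of_exists_ge hc
    ⟨x₁, by linarith⟩ ⟨x₂, h₂.le⟩
  exact ⟨x, by
    change Circle.exp (h x) = _
    rw [hx]; exact Circle.periodic_exp.nat_mul n t⟩

theorem isEssentialMap_of_extends {X : Type*} [MetricSpace X] [PreconnectedSpace X] {p : ℕ∞}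
    (hp : p ≠ 0) {h : X → ℝ} (hc : Continuous h) (hu : ¬ BddAbove (range h))
    (E : C(HigsonCompactification X, Solenoid p))
    (hE : ∀ x n, (E (toHigson x)).1 n = Circle.exp (h x / solenoidIndex p n)) :
    IsEssentialMap E := by
  intro g hg
  refine surjective_of_surjective_coordinates g fun n => ?_
  obtain ⟨u, hgu⟩ := exists_lift_of_homotopic_circle
    (f := (Solenoid.coord p n).comp E) (g := (Solenoid.coord p n).comp g)
    ((ContinuousMap.Homotopic.refl _).comp hg)
  -- Compactness bounds `u` below, so adding it to the unbounded angle leaves it unbounded above.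
  obtain ⟨C, hC⟩ := (isCompact_range u.continuous).bddBelow
  have hι : Continuous fun x : X => u (toHigson x) := u.continuous.comp continuous_toHigson
  have hN : (0 : ℝ) < solenoidIndex p n := by exact_mod_cast solenoidIndex_pos hp n
  have hsurj := surjective_circle_exp_of_not_bddAbove
    (h := fun x : X => h x / solenoidIndex p n + u (toHigson x)) ((hc.div_const _).add hι) (by
      rw [not_bddAbove_iff] at hu ⊢
      intro b
      obtain ⟨_, ⟨x, rfl⟩, hx⟩ := hu ((b - C) * solenoidIndex p n)
      refine ⟨_, ⟨x, rfl⟩, ?_⟩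
      have h1 := (lt_div_iff₀ hN).2 hx
      have h2 := hC (mem_range_self (toHigson x))
      change b < h x / solenoidIndex p n + u (toHigson x)
      linarith)
  intro w
  obtain ⟨x, hx⟩ := hsurj w
  refine ⟨toHigson x, ?_⟩
  refine Eq.trans (hgu (toHigson x)) ?_
  rw [← hx]
  beta_reduce
  change (E (toHigson x)).1 n * _ = _
  exact (by rw [hE, Circle.exp_add])

theorem not_bddAbove_range_log_dist {X : Type*} [MetricSpace X] [ProperSpace X]
    [NoncompactSpace X] (x₀ : X) : ¬ BddAbove (range fun x => Real.log (1 + dist x x₀)) := by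
  have h1 : Tendsto (fun x => Real.log (1 + dist x x₀)) (cocompact X) atTop :=
    Real.tendsto_log_atTop.comp
      (tendsto_atTop_add_const_left _ _ (tendsto_dist_right_cocompact_atTop x₀))
  exact not_bddAbove_of_tendsto_atTop h1

theorem mainTheorem4 (p : ℕ∞) (hp : p ≠ 0) (X : Type u) [MetricSpace X] [ProperSpace X]
    [SimplyConnectedSpace X] [NoncompactSpace X] (hX : IsGeodesicSpace X) :
    ∃ (A : Type u) (F : C(HigsonCompactification X, A → Solenoid p)),
      IsEssentialEmbedding F := by
  obtain ⟨x₀⟩ : Nonempty X := inferInstance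
  let ℓ : X → ℝ := fun x => Real.log (1 + dist x x₀)
  have hℓ : Continuous ℓ := Continuous.log (by fun_prop) fun x => by positivity
  have hcont (f : HigsonFunction X) : Continuous fun x => ℓ x + f.1 x :=
    hℓ.add f.1.continuous
  choose E hE using fun f : HigsonFunction X =>
    exists_extension_solenoid hp _ (hcont f) ((slowlyOscillating_log_dist x₀).add f.2)
  have hunb (f : HigsonFunction X) : ¬ BddAbove (range fun x => ℓ x + f.1 x) := by
    intro hb
    obtain ⟨b, hb⟩ := hb
    obtain ⟨c, hc⟩ := f.1.isBounded_range.bddBelow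
    refine not_bddAbove_range_log_dist x₀ ⟨b - c, ?_⟩
    rintro _ ⟨x, rfl⟩
    have h1 : ℓ x + f.1 x ≤ b := hb (mem_range_self x)
    have h2 := hc (mem_range_self x)
    exact (by linarith : ℓ x ≤ b - c)
  let F : C(HigsonCompactification X, HigsonFunction X → Solenoid p) :=
    ⟨fun z f => E f z, by fun_prop⟩
  let scale (c : ℝ) (f : HigsonFunction X) : HigsonFunction X :=
    ⟨c • f.1, f.2.comp_lipschitzWith (lipschitzWith_const_mul c)⟩
  -- `scale 0 f` is the zero function, so on `X` its coordinate `0` is `exp (i ℓ)`; the identity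
  -- extends by density.
  have hscale (c : ℝ) (f : HigsonFunction X) (z : HigsonCompactification X) :
      (E (scale c f) z).1 0 = (E (scale 0 f) z).1 0 * Circle.exp (c * f.extend z) := by
    refine denseRange_toHigson.induction_on
      (p := fun z => (E (scale c f) z).1 0 = (E (scale 0 f) z).1 0 * Circle.exp (c * f.extend z)) z
      (isClosed_eq ((Solenoid.coord p 0).comp (E _)).continuous
        (((Solenoid.coord p 0).comp (E _)).continuous.mul (by fun_prop))) fun x => ?_
    rw [hE, hE, ← Circle.exp_add]
    simp [scale, solenoidIndex, HigsonFunction.extend_toHigson]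
  refine ⟨HigsonFunction X, F, ?_, fun f => isEssentialMap_of_extends hp (hcont f) (hunb f) _
    (hE f)⟩
  refine (F.continuous.isClosedEmbedding fun z w hzw => ?_).isEmbedding
  refine HigsonCompactification.ext_of_extend fun f => ?_
  by_contra hne
  have hd : f.extend z - f.extend w ≠ 0 := sub_ne_zero.2 hne
  have hEq (f : HigsonFunction X) : E f z = E f w := congrFun hzw f
  have key (c : ℝ) : Circle.exp (c * f.extend z) = Circle.exp (c * f.extend w) := by
    have h := hscale c f z
    rw [hEq, hEq, hscale c f w] at h
    exact (mul_left_cancel h).symm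
  -- Choosing `c = π / (f z - f w)` in `key` would force `exp (i π) = 1`.
  apply Circle.exp_pi_ne_one
  rw [← div_mul_cancel₀ Real.pi hd, mul_sub, Circle.exp_sub, key, div_self']
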